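/- Let $\Sigma, U_0\in\mathbb{R}^{n\times n}$ be symmetric positive definite matrices with $\Sigma U_0=U_0\Sigma$. Let $\pi\propto\exp(-\tfrac12 q\cdot\Sigma^{-1}q)\,dq$ on $\mathbb{R}^n$, let $\tilde\pi\propto\exp(-\tfrac12 q\cdot\Sigma^{-1}q-\tfrac12 p\cdot p)\,dq\,dp$ on $\mathbb{R}^{2n}$, and let $f(q)=\tfrac12 q\cdot U_0q$, $\pi(f)=\int f\,d\pi$. For a symmetric positive definite friction matrix $\Gamma$, the generator of the underdamped Langevin dynamics with mass matrix $M=I_n$ is $$\mathcal{L}=p\cdot\nabla_q-\Sigma^{-1}q\cdot\nabla_p-\Gamma p\cdot\nabla_p+\nabla_p\cdot\Gamma\nabla_p .$$ Let $\mathbb{S}_\Sigma$ be the set of symmetric positive definite matrices commuting with $\Sigma$. For each $\Gamma\in\mathbb{S}_\Sigma$ the Poisson equation $$-\mathcal{L}\phi=f-\pi(f),\qquad \phi\in L^2(\tilde\pi),\quad \int\phi\,d\tilde\pi=0,$$ has a solution $\phi=\phi_\Gamma$ that is smooth and satisfies the equation both pointwise and in the sense of distributions, and the asymptotic variance $$\sigma^2(\Gamma)=2\int\phi\,(f-\pi(f))\,d\tilde\pi$$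 is well defined, that is, it takes the same value for every distributional solution $\phi$. Moreover $$\min_{\Gamma\in\mathbb{S}_\Sigma}\sigma^2(\Gamma)=\operatorname{Tr}\big(U_0^2\,\Sigma^{5/2}\big),$$ and the minimum is attained at $\Gamma=\Sigma^{-1/2}\in\mathbb{S}_\Sigma$. -/

import Mathlib

open MeasureTheory Matrix
open scoped ContDiff MatrixOrder

noncomputable section

namespace Langevin

/-- The phase space `ℝⁿ × ℝⁿ` of pairs `z = (q, p)`. -/
abbrev Phase (n : ℕ) : Type := (Fin n → ℝ) × (Fin n → ℝ)

variable {n : ℕ}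

/-- The potential `U(q) = ½ q · S⁻¹ q` of the centred Gaussian with covariance `S`. -/
def potential (S : Matrix (Fin n) (Fin n) ℝ) (q : Fin n → ℝ) : ℝ :=
  (1 / 2) * (q ⬝ᵥ (S⁻¹ *ᵥ q))

/-- The Gaussian target `π ∝ exp (-U(q)) dq` on positions. -/
def target (S : Matrix (Fin n) (Fin n) ℝ) : Measure (Fin n → ℝ) :=
  (volume : Measure (Fin n → ℝ)).tilted fun q => -potential S q

/-- The invariant measure `π̃ ∝ exp (-U(q) - ½ p · p) dq dp` (unit mass matrix). -/
def gibbs (S : Matrix (Fin n) (Fin n) ℝ) : Measure (Phase n) :=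
  (volume : Measure (Phase n)).tilted fun z => -potential S z.1 - (1 / 2) * (z.2 ⬝ᵥ z.2)

/-- The observable `f(q) = ½ q · U₀ q`. -/
def observable (U₀ : Matrix (Fin n) (Fin n) ℝ) (q : Fin n → ℝ) : ℝ :=
  (1 / 2) * (q ⬝ᵥ (U₀ *ᵥ q))

/-- The centred observable `f - π(f)`, as a function on phase space. -/
def centred (S U₀ : Matrix (Fin n) (Fin n) ℝ) (z : Phase n) : ℝ :=
  observable U₀ z.1 - ∫ q, observable U₀ q ∂(target S)

/-- The gradient in the position variable. -/
def gradQ (φ : Phase n → ℝ) (z : Phase n) : Fin n → ℝ :=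
  fun i => fderiv ℝ φ z (Pi.single i 1, 0)

/-- The gradient in the momentum variable. -/
def gradP (φ : Phase n → ℝ) (z : Phase n) : Fin n → ℝ :=
  fun i => fderiv ℝ φ z (0, Pi.single i 1)

/-- The second order operator `∇ₚ · Γ ∇ₚ`. -/
def divGradP (Γ : Matrix (Fin n) (Fin n) ℝ) (φ : Phase n → ℝ) (z : Phase n) : ℝ :=
  ∑ i, gradP (fun w => (Γ *ᵥ gradP φ w) i) z i

/-- The generator of the underdamped Langevin dynamics with unit mass and friction `Γ`:
`ℒ = p · ∇_q - S⁻¹ q · ∇ₚ - Γ p · ∇ₚ + ∇ₚ · Γ ∇ₚ`. -/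
def generator (S Γ : Matrix (Fin n) (Fin n) ℝ) (φ : Phase n → ℝ) (z : Phase n) : ℝ :=
  z.2 ⬝ᵥ gradQ φ z - (S⁻¹ *ᵥ z.1) ⬝ᵥ gradP φ z - (Γ *ᵥ z.2) ⬝ᵥ gradP φ z + divGradP Γ φ z

/-- The formal adjoint of `ℒ` in `L²(π̃)`:
`ℒ* = -p · ∇_q + S⁻¹ q · ∇ₚ - Γ p · ∇ₚ + ∇ₚ · Γ ∇ₚ`. -/
def adjointGenerator (S Γ : Matrix (Fin n) (Fin n) ℝ) (g : Phase n → ℝ) (z : Phase n) : ℝ :=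
  -(z.2 ⬝ᵥ gradQ g z) + (S⁻¹ *ᵥ z.1) ⬝ᵥ gradP g z - (Γ *ᵥ z.2) ⬝ᵥ gradP g z + divGradP Γ g z

/-- `φ ∈ L²₀(π̃)` solves the Poisson equation `-ℒ φ = f - π(f)` in the sense of distributions. -/
structure IsPoissonSolution (S U₀ Γ : Matrix (Fin n) (Fin n) ℝ) (φ : Phase n → ℝ) : Prop where
  memLp : MemLp φ 2 (gibbs S)
  mean_zero : ∫ z, φ z ∂(gibbs S) = 0
  weak : ∀ g : Phase n → ℝ, ContDiff ℝ ∞ g → HasCompactSupport g →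
    -∫ z, φ z * adjointGenerator S Γ g z ∂(gibbs S) = ∫ z, centred S U₀ z * g z ∂(gibbs S)

/-- `φ` is smooth, and solves `-ℒ φ = f - π(f)` pointwise. -/
def IsClassicalSolution (S U₀ Γ : Matrix (Fin n) (Fin n) ℝ) (φ : Phase n → ℝ) : Prop :=
  ContDiff ℝ ∞ φ ∧ ∀ z, -generator S Γ φ z = centred S U₀ z

/-- `v` is the asymptotic variance `2 ∫ φ (f - π(f)) dπ̃` for the friction matrix `Γ`: the Poisson
equation has a solution, and the integral has the value `v` for every solution `φ`. -/
def IsAsymptoticVariance (S U₀ Γ : Matrix (Fin n) (Fin n) ℝ) (v : ℝ) : Prop :=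
  (∃ φ, IsPoissonSolution S U₀ Γ φ) ∧
    ∀ φ, IsPoissonSolution S U₀ Γ φ → 2 * ∫ z, φ z * centred S U₀ z ∂(gibbs S) = v

/-- The symmetric positive definite matrices commuting with `S`. -/
def commutingFrictions (S : Matrix (Fin n) (Fin n) ℝ) : Set (Matrix (Fin n) (Fin n) ℝ) :=
  {Γ | Γ.PosDef ∧ Γ * S = S * Γ}

end Langevin

end

/-! The Poisson equation with quadratic data is solved by a quadratic ½ q·Aq + q·Bp + ½ p·Cp.
Matching coefficients gives B = ΓC and A = S⁻¹C + ΓCΓ, where C solves the Lyapunov equation ΓC + CΓ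
= SU₀ (`generator_quadratic`). Since Γ is positive definite, C exists, is unique, commutes with S
and is positive semidefinite.

The variance is found without uniqueness for the Poisson equation. Replacing B by -B (momentum
reversal) gives ψ with -ℒ*ψ = f - π(f). Testing the weak equation of any solution φ with ψ yields ∫
φ (f - π(f)) = ∫ (f - π(f)) ψ, which no longer involves φ; `weak_of_hasTemperateGrowth` allows the
unbounded test function ψ. Gaussian integration by parts evaluates twice the right side as
Tr(SU₀SA).

Finally, with R = S^{1/2}, completing the square (`trace_variance_eq`) writes this as Tr(U₀²S^{5/2})
+ Tr(SU₀ (1 - RΓ) C (1 - RΓ)). The excess is the trace of a product of two positive semidefinite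
matrices, and vanishes when RΓ = 1. Γ need not commute with U₀ or C, so the order of factors matters
throughout. -/

noncomputable section

namespace Langevin

variable {n : ℕ}

/-! ### Integration against exp(-w) for coercive weights w -/

section General

variable {E F : Type*} [NormedAddCommGroup E] [NormedSpace ℝ E]
  [NormedAddCommGroup F] [NormedSpace ℝ F]

theorem hasTemperateGrowth_fderiv {f : E → F} (hf : f.HasTemperateGrowth) :
    (fderiv ℝ f).HasTemperateGrowth := by
  refine ⟨hf.1.fderiv_right (by simp), fun k => ?_⟩
  obtain ⟨m, C, h⟩ := hf.2 (k + 1)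
  exact ⟨m, C, fun x => by simpa [norm_iteratedFDeriv_fderiv] using h x⟩

theorem hasTemperateGrowth_fderiv_apply {f : E → F} (hf : f.HasTemperateGrowth) (v : E) :
    (fun x => fderiv ℝ f x v).HasTemperateGrowth :=
  (ContinuousLinearMap.apply ℝ F v).hasTemperateGrowth.comp (hasTemperateGrowth_fderiv hf)

/-- A positive continuous function that is homogeneous of degree two is coercive. -/
theorem exists_pos_mul_norm_sq_le [FiniteDimensional ℝ E] {w : E → ℝ} (hc : Continuous w)
    (hh : ∀ (t : ℝ) x, w (t • x) = t ^ 2 * w x) (hp : ∀ x, x ≠ 0 → 0 < w x) :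
    ∃ c > 0, ∀ x, c * ‖x‖ ^ 2 ≤ w x := by
  have h0 : w 0 = 0 := by simpa using hh 0 0
  rcases subsingleton_or_nontrivial E with hE | hE
  · exact ⟨1, one_pos, fun x => by simp [Subsingleton.elim x 0, h0]⟩
  -- The constant is the minimum of `w` on the unit sphere; homogeneity carries it to every vector.
  obtain ⟨y, hy, hmin⟩ := (isCompact_sphere (0 : E) 1).exists_isMinOn
    (NormedSpace.sphere_nonempty.2 zero_le_one) hc.continuousOn
  have hy0 : y ≠ 0 := by rintro rfl; simp at hy
  refine ⟨w y, hp y hy0, fun x => ?_⟩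
  rcases eq_or_ne x 0 with rfl | hx
  · simp [h0]
  have hx' : ‖x‖ ≠ 0 := norm_ne_zero_iff.2 hx
  have h1 : w y ≤ w (‖x‖⁻¹ • x) := hmin (by simp [norm_smul, hx'])
  rw [hh] at h1
  calc w y * ‖x‖ ^ 2 ≤ (‖x‖⁻¹ ^ 2 * w x) * ‖x‖ ^ 2 := by gcongr
    _ = w x := by field_simp

theorem exists_one_add_pow_mul_exp_le {c : ℝ} (hc : 0 < c) (k : ℕ) :
    ∃ K, ∀ t : ℝ, 0 ≤ t → (1 + t) ^ k * Real.exp (-(c * t ^ 2)) ≤ K := by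
  -- The exponential series bounds the power by k! e^(1+t), and completing the square gives t - ct²
  -- ≤ 1/(4c).
  refine ⟨k.factorial * Real.exp (1 + 1 / (4 * c)), fun t ht => ?_⟩
  have h1 : (1 + t) ^ k ≤ k.factorial * Real.exp (1 + t) := by
    have := Real.pow_div_factorial_le_exp (1 + t) (by positivity) k
    rwa [div_le_iff₀' (by positivity)] at this
  calc (1 + t) ^ k * Real.exp (-(c * t ^ 2))
      ≤ (k.factorial * Real.exp (1 + t)) * Real.exp (-(c * t ^ 2)) := by gcongr
    _ = k.factorial * Real.exp (1 + t - c * t ^ 2) := by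
        rw [mul_assoc, ← Real.exp_add]; ring_nf
    _ ≤ _ := by
        gcongr
        have : 0 ≤ c * (t - 1 / (2 * c)) ^ 2 := by positivity
        have h2 : c * (t - 1 / (2 * c)) ^ 2 = c * t ^ 2 - t + 1 / (4 * c) := by
          field_simp; ring
        linarith

theorem integrable_exp_neg_mul_of_pow_bound [FiniteDimensional ℝ E] [MeasurableSpace E]
    [BorelSpace E] {μ : Measure E} [μ.IsAddHaarMeasure] {w g : E → ℝ} (hw : Continuous w)
    {c : ℝ} (hc : 0 < c) (hcw : ∀ x, c * ‖x‖ ^ 2 ≤ w x)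
    (hg : AEStronglyMeasurable g μ) {C : ℝ} {k : ℕ} (hgC : ∀ x, ‖g x‖ ≤ C * (1 + ‖x‖) ^ k) :
    Integrable (fun x => Real.exp (-w x) * g x) μ := by
  -- The weight also absorbs `m` further powers of 1 + ‖x‖; one more than the dimension makes (1 +
  -- ‖x‖)^(-m) integrable.
  set m := Module.finrank ℝ E + 1
  obtain ⟨K, hK⟩ := exists_one_add_pow_mul_exp_le hc (k + m)
  have hC : 0 ≤ C := by simpa using (norm_nonneg _).trans (hgC 0)
  have hint : Integrable (fun x : E => (1 + ‖x‖) ^ (-(m : ℝ))) μ :=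
    integrable_one_add_norm (by simp [m])
  refine (hint.const_mul (C * K)).mono' ((by fun_prop : Continuous fun x =>
    Real.exp (-w x)).aestronglyMeasurable.mul hg) (.of_forall fun x => ?_)
  have hpos : (0 : ℝ) < (1 + ‖x‖) ^ m := by positivity
  rw [Real.rpow_neg (by positivity), Real.rpow_natCast, ← div_eq_mul_inv, le_div_iff₀ hpos,
    norm_mul, Real.norm_of_nonneg (Real.exp_pos _).le]
  calc Real.exp (-w x) * ‖g x‖ * (1 + ‖x‖) ^ m
      ≤ Real.exp (-(c * ‖x‖ ^ 2)) * (C * (1 + ‖x‖) ^ k) * (1 + ‖x‖) ^ m := by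
        gcongr
        · exact hcw x
        · exact hgC x
    _ = C * ((1 + ‖x‖) ^ (k + m) * Real.exp (-(c * ‖x‖ ^ 2))) := by ring
    _ ≤ C * K := by gcongr; exact hK _ (norm_nonneg _)

theorem integrable_exp_neg_mul [FiniteDimensional ℝ E] [MeasurableSpace E] [BorelSpace E]
    {μ : Measure E} [μ.IsAddHaarMeasure] {w g : E → ℝ} (hw : Continuous w)
    {c : ℝ} (hc : 0 < c) (hcw : ∀ x, c * ‖x‖ ^ 2 ≤ w x) (hg : g.HasTemperateGrowth) :
    Integrable (fun x => Real.exp (-w x) * g x) μ := by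
  obtain ⟨k, C, h⟩ := hg.2 0
  exact integrable_exp_neg_mul_of_pow_bound hw hc hcw hg.1.continuous.aestronglyMeasurable
    (by simpa using h)

/-- Integration by parts against the weight `exp (-w)`. -/
theorem integral_exp_neg_mul_fderiv [FiniteDimensional ℝ E] [MeasurableSpace E] [BorelSpace E]
    {μ : Measure E} [μ.IsAddHaarMeasure] {w g : E → ℝ} (hw : w.HasTemperateGrowth)
    {c : ℝ} (hc : 0 < c) (hcw : ∀ x, c * ‖x‖ ^ 2 ≤ w x) (hg : g.HasTemperateGrowth) (v : E) :
    ∫ x, Real.exp (-w x) * fderiv ℝ g x v ∂μ =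
      ∫ x, Real.exp (-w x) * (fderiv ℝ w x v * g x) ∂μ := by
  have hwd : Differentiable ℝ w := hw.1.differentiable (by simp)
  have hgd : Differentiable ℝ g := hg.1.differentiable (by simp)
  have hd : ∀ x, fderiv ℝ (fun y => Real.exp (-w y)) x v = -(Real.exp (-w x) * fderiv ℝ w x v) := by
    intro x
    rw [(hwd x).hasFDerivAt.fun_neg.exp.fderiv]
    simp
  have hwv := hasTemperateGrowth_fderiv_apply hw v
  have hgv := hasTemperateGrowth_fderiv_apply hg v
  rw [integral_mul_fderiv_eq_neg_fderiv_mul_of_integrable]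
  · rw [← integral_neg]
    refine integral_congr_ae (.of_forall fun x => ?_)
    simp only [hd]; ring
  · refine (integrable_exp_neg_mul (μ := μ) hw.1.continuous hc hcw (hwv.mul hg)).neg.congr
      (.of_forall fun x => ?_)
    simp only [hd, Pi.neg_apply, Pi.mul_apply]; ring
  · exact integrable_exp_neg_mul hw.1.continuous hc hcw hgv
  · exact integrable_exp_neg_mul hw.1.continuous hc hcw hg
  · intro x _; exact (hwd x).neg.exp
  · intro x _; exact hgd x

end General


/-! ### Derivatives of quadratic functions on phase space -/

/-- The quadratic function `½ q · A q + q · B p + ½ p · C p` on phase space. -/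
def quadratic (A B C : Matrix (Fin n) (Fin n) ℝ) (z : Phase n) : ℝ :=
  (1 / 2) * (z.1 ⬝ᵥ (A *ᵥ z.1)) + z.1 ⬝ᵥ (B *ᵥ z.2) + (1 / 2) * (z.2 ⬝ᵥ (C *ᵥ z.2))

instance : (volume : Measure (Phase n)).IsAddHaarMeasure :=
  Measure.prod.instIsAddHaarMeasure (volume : Measure (Fin n → ℝ)) (volume : Measure (Fin n → ℝ))

@[fun_prop]
theorem hasTemperateGrowth_fst_apply (i : Fin n) :
    (fun z : Phase n => z.1 i).HasTemperateGrowth :=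
  ((ContinuousLinearMap.proj i).comp
    (ContinuousLinearMap.fst ℝ (Fin n → ℝ) (Fin n → ℝ))).hasTemperateGrowth

@[fun_prop]
theorem hasTemperateGrowth_snd_apply (i : Fin n) :
    (fun z : Phase n => z.2 i).HasTemperateGrowth :=
  ((ContinuousLinearMap.proj i).comp
    (ContinuousLinearMap.snd ℝ (Fin n → ℝ) (Fin n → ℝ))).hasTemperateGrowth

theorem hasTemperateGrowth_dotProduct {E : Type*} [NormedAddCommGroup E] [NormedSpace ℝ E]
    {u v : E → Fin n → ℝ} (hu : ∀ i, (fun x => u x i).HasTemperateGrowth)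
    (hv : ∀ i, (fun x => v x i).HasTemperateGrowth) :
    (fun x => u x ⬝ᵥ v x).HasTemperateGrowth := by
  simp only [dotProduct]
  exact .sum fun i _ => (hu i).mul (hv i)

theorem hasTemperateGrowth_mulVec {E : Type*} [NormedAddCommGroup E] [NormedSpace ℝ E]
    (M : Matrix (Fin n) (Fin n) ℝ) {v : E → Fin n → ℝ}
    (hv : ∀ i, (fun x => v x i).HasTemperateGrowth) (i : Fin n) :
    (fun x => (M *ᵥ v x) i).HasTemperateGrowth := by
  simp only [mulVec]
  exact hasTemperateGrowth_dotProduct (fun j => .const _) hv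

theorem hasTemperateGrowth_quadratic (A B C : Matrix (Fin n) (Fin n) ℝ) :
    (quadratic A B C).HasTemperateGrowth := by
  have h1 := hasTemperateGrowth_fst_apply (n := n)
  have h2 := hasTemperateGrowth_snd_apply (n := n)
  exact (((Function.HasTemperateGrowth.const _).mul (hasTemperateGrowth_dotProduct h1
    (hasTemperateGrowth_mulVec A h1))).add (hasTemperateGrowth_dotProduct h1
    (hasTemperateGrowth_mulVec B h2))).add ((Function.HasTemperateGrowth.const _).mul
    (hasTemperateGrowth_dotProduct h2 (hasTemperateGrowth_mulVec C h2)))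

theorem dotProduct_mulVec_symm {M : Matrix (Fin n) (Fin n) ℝ} (hM : Mᵀ = M) (x y : Fin n → ℝ) :
    x ⬝ᵥ (M *ᵥ y) = y ⬝ᵥ (M *ᵥ x) := by
  rw [dotProduct_mulVec, ← mulVec_transpose, hM, dotProduct_comm]

/-- Along a line the quadratic is an exact polynomial in t, and the derivative is its linear
coefficient. Symmetry of `A` and `C` merges the two cross terms and cancels the factor ½. -/
theorem fderiv_quadratic {A B C : Matrix (Fin n) (Fin n) ℝ} (hA : Aᵀ = A) (hC : Cᵀ = C)
    (z v : Phase n) :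
    fderiv ℝ (quadratic A B C) z v =
      v.1 ⬝ᵥ (A *ᵥ z.1 + B *ᵥ z.2) + v.2 ⬝ᵥ (Bᵀ *ᵥ z.1 + C *ᵥ z.2) := by
  have hd : DifferentiableAt ℝ (quadratic A B C) z :=
    (hasTemperateGrowth_quadratic A B C).1.contDiffAt.differentiableAt (by simp)
  rw [← hd.lineDeriv_eq_fderiv]
  set l := v.1 ⬝ᵥ (A *ᵥ z.1 + B *ᵥ z.2) + v.2 ⬝ᵥ (Bᵀ *ᵥ z.1 + C *ᵥ z.2) with hl
  have key : ∀ t : ℝ, quadratic A B C (z + t • v) =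
      quadratic A B C z + t * l + t ^ 2 * quadratic A B C v := by
    intro t
    have e1 := dotProduct_mulVec_symm hA z.1 v.1
    have e2 := dotProduct_mulVec_symm hC z.2 v.2
    have e3 : v.2 ⬝ᵥ (Bᵀ *ᵥ z.1) = z.1 ⬝ᵥ (B *ᵥ v.2) := by
      rw [mulVec_transpose, dotProduct_comm, dotProduct_mulVec]
    simp only [hl, quadratic, Prod.fst_add, Prod.snd_add, Prod.smul_fst, Prod.smul_snd,
      mulVec_add, mulVec_smul, dotProduct_add, add_dotProduct, dotProduct_smul, smul_dotProduct,
      smul_eq_mul, e1, e2, e3]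
    ring
  have h : HasDerivAt (fun t : ℝ => quadratic A B C (z + t • v)) l 0 := by
    simp only [key]
    have h1 := (((hasDerivAt_id (0 : ℝ)).mul_const l).const_add (quadratic A B C z)).add
      (((hasDerivAt_id (0 : ℝ)).pow 2).mul_const (quadratic A B C v))
    convert! h1 using 1
    simp
  exact h.deriv

theorem gradQ_quadratic {A B C : Matrix (Fin n) (Fin n) ℝ} (hA : Aᵀ = A) (hC : Cᵀ = C)
    (z : Phase n) : gradQ (quadratic A B C) z = A *ᵥ z.1 + B *ᵥ z.2 := by
  ext i; simp [gradQ, fderiv_quadratic hA hC]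

theorem gradP_quadratic {A B C : Matrix (Fin n) (Fin n) ℝ} (hA : Aᵀ = A) (hC : Cᵀ = C)
    (z : Phase n) : gradP (quadratic A B C) z = Bᵀ *ᵥ z.1 + C *ᵥ z.2 := by
  ext i; simp [gradP, fderiv_quadratic hA hC]

theorem fderiv_mulVec_fst (M : Matrix (Fin n) (Fin n) ℝ) (i : Fin n) (z v : Phase n) :
    fderiv ℝ (fun w : Phase n => (M *ᵥ w.1) i) z v = (M *ᵥ v.1) i := by
  let L : Phase n →L[ℝ] ℝ := (ContinuousLinearMap.proj i).comp
    ((LinearMap.toContinuousLinearMap (Matrix.mulVecLin M)).comp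
      (ContinuousLinearMap.fst ℝ (Fin n → ℝ) (Fin n → ℝ)))
  exact congrArg (· v) (L.hasFDerivAt (x := z)).fderiv

theorem fderiv_mulVec_snd (M : Matrix (Fin n) (Fin n) ℝ) (i : Fin n) (z v : Phase n) :
    fderiv ℝ (fun w : Phase n => (M *ᵥ w.2) i) z v = (M *ᵥ v.2) i := by
  let L : Phase n →L[ℝ] ℝ := (ContinuousLinearMap.proj i).comp
    ((LinearMap.toContinuousLinearMap (Matrix.mulVecLin M)).comp
      (ContinuousLinearMap.snd ℝ (Fin n → ℝ) (Fin n → ℝ)))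
  exact congrArg (· v) (L.hasFDerivAt (x := z)).fderiv

theorem divGradP_quadratic {A B C : Matrix (Fin n) (Fin n) ℝ} (hA : Aᵀ = A) (hC : Cᵀ = C)
    (Γ : Matrix (Fin n) (Fin n) ℝ) (z : Phase n) :
    divGradP Γ (quadratic A B C) z = (Γ * C).trace := by
  unfold divGradP
  have h : ∀ (i : Fin n) (w : Phase n), (Γ *ᵥ gradP (quadratic A B C) w) i =
      ((Γ * Bᵀ) *ᵥ w.1) i + ((Γ * C) *ᵥ w.2) i := by
    intro i w
    rw [gradP_quadratic hA hC, mulVec_add, mulVec_mulVec, mulVec_mulVec, Pi.add_apply]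
  simp only [h, gradP, trace, diag]
  refine Finset.sum_congr rfl fun i _ => ?_
  have d1 : DifferentiableAt ℝ (fun w : Phase n => ((Γ * Bᵀ) *ᵥ w.1) i) z :=
    (hasTemperateGrowth_mulVec _ hasTemperateGrowth_fst_apply i).1.contDiffAt.differentiableAt
      (by simp)
  have d2 : DifferentiableAt ℝ (fun w : Phase n => ((Γ * C) *ᵥ w.2) i) z :=
    (hasTemperateGrowth_mulVec _ hasTemperateGrowth_snd_apply i).1.contDiffAt.differentiableAt
      (by simp)
  rw [fderiv_fun_add d1 d2, _root_.add_apply, fderiv_mulVec_fst, fderiv_mulVec_snd]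
  simp

/-! ### The Gibbs measure: integrability, integration by parts, marginal -/

/-- The energy `½ q · S⁻¹ q + ½ p · p`. -/
def energy (S : Matrix (Fin n) (Fin n) ℝ) : Phase n → ℝ := quadratic S⁻¹ 0 1

theorem hasTemperateGrowth_energy (S : Matrix (Fin n) (Fin n) ℝ) :
    (energy S).HasTemperateGrowth :=
  hasTemperateGrowth_quadratic _ _ _

theorem gibbs_eq_tilted (S : Matrix (Fin n) (Fin n) ℝ) :
    gibbs S = (volume : Measure (Phase n)).tilted fun z => -energy S z := by
  unfold gibbs
  congr 1
  ext z
  simp [energy, quadratic, potential]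
  ring

theorem transpose_eq {M : Matrix (Fin n) (Fin n) ℝ} (h : M.PosDef) : Mᵀ = M := by
  simpa [IsHermitian] using h.1

theorem transpose_inv_eq {M : Matrix (Fin n) (Fin n) ℝ} (h : M.PosDef) : (M⁻¹)ᵀ = M⁻¹ :=
  transpose_eq h.inv

theorem exists_pos_mul_norm_sq_le_energy {S : Matrix (Fin n) (Fin n) ℝ} (hS : S.PosDef) :
    ∃ c > 0, ∀ z, c * ‖z‖ ^ 2 ≤ energy S z := by
  refine exists_pos_mul_norm_sq_le (hasTemperateGrowth_energy S).1.continuous ?_ ?_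
  · intro t z
    simp [energy, quadratic, mulVec_smul]
    ring
  · intro z hz
    have hq : ∀ q : Fin n → ℝ, 0 ≤ q ⬝ᵥ (S⁻¹ *ᵥ q) := fun q => by
      simpa using hS.inv.posSemidef.dotProduct_mulVec_nonneg q
    have hp : ∀ p : Fin n → ℝ, 0 ≤ p ⬝ᵥ p := fun p => by
      simpa using dotProduct_star_self_nonneg p
    simp only [energy, quadratic, zero_mulVec, dotProduct_zero, one_mulVec, add_zero]
    by_cases h1 : z.1 = 0
    · have h2 : z.2 ≠ 0 := fun h2 => hz (Prod.ext h1 h2)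
      have : 0 < z.2 ⬝ᵥ z.2 := (hp _).lt_of_ne' (by simpa using h2)
      linarith [hq z.1]
    · have : 0 < z.1 ⬝ᵥ (S⁻¹ *ᵥ z.1) := by simpa using hS.inv.dotProduct_mulVec_pos h1
      linarith [hp z.2]

theorem integrable_exp_neg_energy {S : Matrix (Fin n) (Fin n) ℝ} (hS : S.PosDef) :
    Integrable (fun z : Phase n => Real.exp (-energy S z)) := by
  obtain ⟨c, hc, h⟩ := exists_pos_mul_norm_sq_le_energy hS
  simpa using integrable_exp_neg_mul (μ := (volume : Measure (Phase n)))
    (hasTemperateGrowth_energy S).1.continuous hc h (.const (1 : ℝ))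

theorem isProbabilityMeasure_gibbs {S : Matrix (Fin n) (Fin n) ℝ} (hS : S.PosDef) :
    IsProbabilityMeasure (gibbs S) := by
  rw [gibbs_eq_tilted]
  exact isProbabilityMeasure_tilted (integrable_exp_neg_energy hS)

theorem integral_gibbs (S : Matrix (Fin n) (Fin n) ℝ) (g : Phase n → ℝ) :
    ∫ z, g z ∂gibbs S =
      (∫ z, Real.exp (-energy S z) * g z) / ∫ z, Real.exp (-energy S z) := by
  rw [gibbs_eq_tilted, integral_tilted, ← integral_div]
  refine integral_congr_ae (.of_forall fun z => ?_)
  simp only [smul_eq_mul]; ring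

theorem integrable_gibbs {S : Matrix (Fin n) (Fin n) ℝ} (hS : S.PosDef) {g : Phase n → ℝ}
    (hg : g.HasTemperateGrowth) : Integrable g (gibbs S) := by
  obtain ⟨c, hc, h⟩ := exists_pos_mul_norm_sq_le_energy hS
  rw [gibbs_eq_tilted, integrable_tilted_iff (integrable_exp_neg_energy hS)]
  exact integrable_exp_neg_mul (hasTemperateGrowth_energy S).1.continuous hc h hg

theorem integrable_one_add_norm_pow_gibbs {S : Matrix (Fin n) (Fin n) ℝ} (hS : S.PosDef) (k : ℕ) :
    Integrable (fun z : Phase n => (1 + ‖z‖) ^ k) (gibbs S) := by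
  obtain ⟨c, hc, h⟩ := exists_pos_mul_norm_sq_le_energy hS
  rw [gibbs_eq_tilted, integrable_tilted_iff (integrable_exp_neg_energy hS)]
  exact integrable_exp_neg_mul_of_pow_bound (hasTemperateGrowth_energy S).1.continuous hc h
    (by fun_prop) (C := 1) (k := k) (fun x => by
      rw [Real.norm_of_nonneg (by positivity), one_mul])

theorem memLp_two_gibbs {S : Matrix (Fin n) (Fin n) ℝ} (hS : S.PosDef) {g : Phase n → ℝ}
    (hg : g.HasTemperateGrowth) : MemLp g 2 (gibbs S) :=
  (memLp_two_iff_integrable_sq hg.1.continuous.aestronglyMeasurable).2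
    (integrable_gibbs hS (hg.pow 2))

theorem integral_fderiv_gibbs {S : Matrix (Fin n) (Fin n) ℝ} (hS : S.PosDef) {g : Phase n → ℝ}
    (hg : g.HasTemperateGrowth) (v : Phase n) :
    ∫ z, fderiv ℝ g z v ∂gibbs S = ∫ z, fderiv ℝ (energy S) z v * g z ∂gibbs S := by
  obtain ⟨c, hc, h⟩ := exists_pos_mul_norm_sq_le_energy hS
  rw [integral_gibbs, integral_gibbs,
    integral_exp_neg_mul_fderiv (hasTemperateGrowth_energy S) hc h hg]

/-- Gaussian integration by parts in the position variable. -/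
theorem integral_gradQ {S : Matrix (Fin n) (Fin n) ℝ} (hS : S.PosDef) {g : Phase n → ℝ}
    (hg : g.HasTemperateGrowth) (i : Fin n) :
    ∫ z, gradQ g z i ∂gibbs S = ∫ z, (S⁻¹ *ᵥ z.1) i * g z ∂gibbs S := by
  unfold gradQ
  rw [integral_fderiv_gibbs hS hg]
  simp [energy, fderiv_quadratic (transpose_inv_eq hS) transpose_one]

/-- Gaussian integration by parts in the momentum variable. -/
theorem integral_gradP {S : Matrix (Fin n) (Fin n) ℝ} (hS : S.PosDef) {g : Phase n → ℝ}
    (hg : g.HasTemperateGrowth) (i : Fin n) :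
    ∫ z, gradP g z i ∂gibbs S = ∫ z, z.2 i * g z ∂gibbs S := by
  unfold gradP
  rw [integral_fderiv_gibbs hS hg]
  simp [energy, fderiv_quadratic (transpose_inv_eq hS) transpose_one]

/-- The position marginal of the invariant measure is the target. -/
theorem integral_fst_gibbs {S : Matrix (Fin n) (Fin n) ℝ} (hS : S.PosDef)
    (h : (Fin n → ℝ) → ℝ) : ∫ z, h z.1 ∂gibbs S = ∫ q, h q ∂target S := by
  have hZ := integral_exp_pos (integrable_exp_neg_energy hS)
  have he : ∀ z : Phase n, Real.exp (-energy S z) =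
      Real.exp (-potential S z.1) * Real.exp (-((1 / 2) * (z.2 ⬝ᵥ z.2))) := by
    intro z
    rw [← Real.exp_add]
    simp [energy, quadratic, potential]
    ring
  have e1 : ∫ z : Phase n, Real.exp (-energy S z) = (∫ q, Real.exp (-potential S q)) *
      ∫ p : Fin n → ℝ, Real.exp (-((1 / 2) * (p ⬝ᵥ p))) := by
    simp only [he]
    exact integral_prod_mul (μ := volume) (ν := volume) (fun q => Real.exp (-potential S q))
      (fun p : Fin n → ℝ => Real.exp (-((1 / 2) * (p ⬝ᵥ p))))
  -- The density factorizes, and the product formula for integrals needs no integrability, so `h`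
  -- can be arbitrary.
  have e2 : ∫ z : Phase n, Real.exp (-energy S z) * h z.1 =
      (∫ q, Real.exp (-potential S q) * h q) *
      ∫ p : Fin n → ℝ, Real.exp (-((1 / 2) * (p ⬝ᵥ p))) := by
    rw [← integral_prod_mul (μ := volume) (ν := volume) (fun q => Real.exp (-potential S q) * h q)
      (fun p : Fin n → ℝ => Real.exp (-((1 / 2) * (p ⬝ᵥ p))))]
    refine integral_congr_ae (.of_forall fun z => ?_)
    simp only [he]; ring
  rw [integral_gibbs, target, integral_tilted, e2, e1]
  rw [e1] at hZ
  have hp := (mul_ne_zero_iff.1 hZ.ne').2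
  rw [mul_div_mul_right _ _ hp, ← integral_div]
  refine integral_congr_ae (.of_forall fun z => ?_)
  simp only [smul_eq_mul]; ring


/-! ### Extending the weak formulation to test functions of temperate growth -/

section Parametric

variable {H : Phase n × ℝ → ℝ}

theorem hasTemperateGrowth_slice (hH : H.HasTemperateGrowth) (t : ℝ) :
    (fun z => H (z, t)).HasTemperateGrowth := by
  have h : (fun z : Phase n => (z, t)).HasTemperateGrowth := by
    have : (fun z : Phase n => (z, t)) = fun z =>
        ContinuousLinearMap.inl ℝ (Phase n) ℝ z + (0, t) := by ext <;> simp
    rw [this]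
    fun_prop
  exact hH.comp h

theorem hasTemperateGrowth_comp_fst {g : Phase n → ℝ} (hg : g.HasTemperateGrowth) :
    (fun x : Phase n × ℝ => g x.1).HasTemperateGrowth :=
  hg.comp (ContinuousLinearMap.fst ℝ (Phase n) ℝ).hasTemperateGrowth

theorem fderiv_slice (hH : H.HasTemperateGrowth) (t : ℝ) (z v : Phase n) :
    fderiv ℝ (fun w => H (w, t)) z v = fderiv ℝ H (z, t) (v, 0) := by
  have hd : HasFDerivAt H (fderiv ℝ H (z, t)) (z, t) :=
    (hH.1.contDiffAt.differentiableAt (by simp)).hasFDerivAt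
  have := hd.comp z (hasFDerivAt_prodMk_left (𝕜 := ℝ) z t)
  rw [show (fun w => H (w, t)) = H ∘ fun w => (w, t) from rfl, this.fderiv]
  simp

theorem hasTemperateGrowth_gradQ_slice (hH : H.HasTemperateGrowth) (i : Fin n) :
    (fun x : Phase n × ℝ => gradQ (fun w => H (w, x.2)) x.1 i).HasTemperateGrowth := by
  simp only [gradQ, fderiv_slice hH]
  exact hasTemperateGrowth_fderiv_apply hH _

theorem hasTemperateGrowth_gradP_slice (hH : H.HasTemperateGrowth) (i : Fin n) :
    (fun x : Phase n × ℝ => gradP (fun w => H (w, x.2)) x.1 i).HasTemperateGrowth := by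
  simp only [gradP, fderiv_slice hH]
  exact hasTemperateGrowth_fderiv_apply hH _

theorem hasTemperateGrowth_divGradP_slice (Γ : Matrix (Fin n) (Fin n) ℝ)
    (hH : H.HasTemperateGrowth) :
    (fun x : Phase n × ℝ => divGradP Γ (fun w => H (w, x.2)) x.1).HasTemperateGrowth := by
  unfold divGradP
  exact .sum fun i _ => hasTemperateGrowth_gradP_slice
    (H := fun x => (Γ *ᵥ gradP (fun w => H (w, x.2)) x.1) i)
    (hasTemperateGrowth_mulVec Γ (hasTemperateGrowth_gradP_slice hH) i) i

/-- The cutoff scale is an extra variable t, and ℒ* acts with t frozen. Joint temperate growth in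
(z, t) then controls all derivatives of the cutoff at once, with no commutator computed. -/
theorem hasTemperateGrowth_adjointGenerator_slice (S Γ : Matrix (Fin n) (Fin n) ℝ)
    (hH : H.HasTemperateGrowth) :
    (fun x : Phase n × ℝ =>
      adjointGenerator S Γ (fun w => H (w, x.2)) x.1).HasTemperateGrowth := by
  have h1 : ∀ i, (fun x : Phase n × ℝ => x.1.1 i).HasTemperateGrowth := fun i =>
    hasTemperateGrowth_comp_fst (hasTemperateGrowth_fst_apply i)
  have h2 : ∀ i, (fun x : Phase n × ℝ => x.1.2 i).HasTemperateGrowth := fun i =>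
    hasTemperateGrowth_comp_fst (hasTemperateGrowth_snd_apply i)
  have hP := hasTemperateGrowth_gradP_slice hH
  exact (((hasTemperateGrowth_dotProduct h2 (hasTemperateGrowth_gradQ_slice hH)).neg.add
    (hasTemperateGrowth_dotProduct (hasTemperateGrowth_mulVec _ h1) hP)).sub
    (hasTemperateGrowth_dotProduct (hasTemperateGrowth_mulVec _ h2) hP)).add
    (hasTemperateGrowth_divGradP_slice Γ hH)

/-- Dominated convergence: for t in [0, 1] all slices lie below one polynomial in ‖z‖, which is in
L² of the Gibbs measure and hence integrable against `u`. -/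
theorem tendsto_integral_slice {S : Matrix (Fin n) (Fin n) ℝ} (hS : S.PosDef) {u : Phase n → ℝ}
    (hu : MemLp u 2 (gibbs S)) (hH : H.HasTemperateGrowth) :
    Filter.Tendsto (fun k : ℕ => ∫ z, u z * H (z, 1 / ((k : ℝ) + 1)) ∂gibbs S) Filter.atTop
      (nhds (∫ z, u z * H (z, 0) ∂gibbs S)) := by
  obtain ⟨m, C, hC⟩ := hH.2 0
  simp only [norm_iteratedFDeriv_zero] at hC
  have hC0 : 0 ≤ C := by simpa using (norm_nonneg _).trans (hC 0)
  have hpow : MemLp (fun z : Phase n => (1 + ‖z‖) ^ m) 2 (gibbs S) := by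
    refine (memLp_two_iff_integrable_sq (by fun_prop)).2 ?_
    simp only [← pow_mul]
    exact integrable_one_add_norm_pow_gibbs hS _
  refine tendsto_integral_of_dominated_convergence
    (fun z => ‖u z‖ * (C * 2 ^ m * (1 + ‖z‖) ^ m)) (fun k => ?_) ?_ (fun k => ?_) ?_
  · exact hu.1.mul (hasTemperateGrowth_slice hH _).1.continuous.aestronglyMeasurable
  · exact hu.norm.integrable_mul (hpow.const_mul (C * 2 ^ m))
  · refine .of_forall fun z => ?_
    rw [norm_mul]
    gcongr
    refine (hC _).trans ?_
    -- The factor 2^m comes from 1 + ‖(z, t)‖ ≤ 2 (1 + ‖z‖) for |t| ≤ 1.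
    rw [mul_assoc, ← mul_pow]
    gcongr
    have ht : ‖1 / ((k : ℝ) + 1)‖ ≤ 1 := by
      rw [Real.norm_of_nonneg (by positivity)]
      exact div_le_one_of_le₀ (by linarith [(Nat.cast_nonneg k : (0 : ℝ) ≤ k)]) (by positivity)
    rw [Prod.norm_mk]
    rcases max_cases ‖z‖ ‖1 / ((k : ℝ) + 1)‖ with h | h <;> linarith [norm_nonneg z]
  · refine .of_forall fun z => Filter.Tendsto.const_mul _ ?_
    exact ((hH.1.continuous.comp (Continuous.prodMk_right z)).tendsto 0).comp
      tendsto_one_div_add_atTop_nhds_zero_nat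

end Parametric

/-- A weak formulation against compactly supported test functions extends to all test functions
of temperate growth. -/
theorem weak_of_hasTemperateGrowth {S Γ : Matrix (Fin n) (Fin n) ℝ} (hS : S.PosDef)
    {φ T : Phase n → ℝ} (hφ : MemLp φ 2 (gibbs S)) (hT : MemLp T 2 (gibbs S))
    (hweak : ∀ g : Phase n → ℝ, ContDiff ℝ ∞ g → HasCompactSupport g →
      -∫ z, φ z * adjointGenerator S Γ g z ∂(gibbs S) = ∫ z, T z * g z ∂(gibbs S))
    {ψ : Phase n → ℝ} (hψ : ψ.HasTemperateGrowth) :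
    -∫ z, φ z * adjointGenerator S Γ ψ z ∂(gibbs S) = ∫ z, T z * ψ z ∂(gibbs S) := by
  let χ : ContDiffBump (0 : Phase n) := ⟨1, 2, one_pos, one_lt_two⟩
  have hχ : (χ : Phase n → ℝ).HasTemperateGrowth :=
    χ.hasCompactSupport.hasTemperateGrowth χ.contDiff
  -- At t = 0 the cutoff is χ(0) = 1 and the slice is `ψ` itself; at t = 1/(k+1) the slice has
  -- compact support, so the hypothesis applies to it.
  let H : Phase n × ℝ → ℝ := fun x => χ (x.2 • x.1) * ψ x.1
  have hH : H.HasTemperateGrowth := by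
    have h1 : (fun x : Phase n × ℝ => x.2).HasTemperateGrowth :=
      (ContinuousLinearMap.snd ℝ (Phase n) ℝ).hasTemperateGrowth
    have h2 : (fun x : Phase n × ℝ => x.1).HasTemperateGrowth :=
      (ContinuousLinearMap.fst ℝ (Phase n) ℝ).hasTemperateGrowth
    exact (hχ.comp (h1.smul h2)).mul (hasTemperateGrowth_comp_fst hψ)
  have hH0 : (fun w => H (w, 0)) = ψ := by
    ext w
    have : χ (0 : Phase n) = 1 := χ.one_of_mem_closedBall (by simp [χ])
    simp [H, this]
  have lim1 := (tendsto_integral_slice hS hφ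
    (hasTemperateGrowth_adjointGenerator_slice S Γ hH)).neg
  have lim2 := tendsto_integral_slice hS hT hH
  simp only [hH0] at lim1
  simp only [show ∀ w, H (w, 0) = ψ w from congrFun hH0] at lim2
  refine tendsto_nhds_unique (lim1.congr fun k => ?_) lim2
  refine hweak _ (hasTemperateGrowth_slice hH _).1 ?_
  have : (1 / ((k : ℝ) + 1)) ≠ 0 := by positivity
  exact (χ.hasCompactSupport.comp_smul this).mul_right

/-! ### Divergence theorems and adjointness of ℒ and ℒ* -/

section Green

variable {S : Matrix (Fin n) (Fin n) ℝ} {g φ : Phase n → ℝ}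

theorem hasTemperateGrowth_gradQ (hg : g.HasTemperateGrowth) (i : Fin n) :
    (fun z => gradQ g z i).HasTemperateGrowth := hasTemperateGrowth_fderiv_apply hg _

theorem hasTemperateGrowth_gradP (hg : g.HasTemperateGrowth) (i : Fin n) :
    (fun z => gradP g z i).HasTemperateGrowth := hasTemperateGrowth_fderiv_apply hg _

theorem hasTemperateGrowth_mulVec_fst (S : Matrix (Fin n) (Fin n) ℝ) (i : Fin n) :
    (fun z : Phase n => (S *ᵥ z.1) i).HasTemperateGrowth :=
  hasTemperateGrowth_mulVec _ hasTemperateGrowth_fst_apply i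

theorem integrable_sum_gradQ_sub (hS : S.PosDef) {h : Fin n → Phase n → ℝ}
    (hh : ∀ i, (h i).HasTemperateGrowth) :
    Integrable (fun z => ∑ i, (gradQ (h i) z i - (S⁻¹ *ᵥ z.1) i * h i z)) (gibbs S) :=
  integrable_finsetSum _ fun i _ => integrable_gibbs hS ((hasTemperateGrowth_gradQ (hh i) i).sub
    ((hasTemperateGrowth_mulVec_fst _ i).mul (hh i)))

theorem integrable_sum_gradP_sub (hS : S.PosDef) {h : Fin n → Phase n → ℝ}
    (hh : ∀ i, (h i).HasTemperateGrowth) :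
    Integrable (fun z => ∑ i, (gradP (h i) z i - z.2 i * h i z)) (gibbs S) :=
  integrable_finsetSum _ fun i _ => integrable_gibbs hS ((hasTemperateGrowth_gradP (hh i) i).sub
    ((hasTemperateGrowth_snd_apply i).mul (hh i)))

/-- The divergence theorem for a vector field on positions, with respect to the Gibbs measure. -/
theorem integral_sum_gradQ_sub (hS : S.PosDef) {h : Fin n → Phase n → ℝ}
    (hh : ∀ i, (h i).HasTemperateGrowth) :
    ∫ z, ∑ i, (gradQ (h i) z i - (S⁻¹ *ᵥ z.1) i * h i z) ∂gibbs S = 0 := by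
  have i1 := fun i => integrable_gibbs hS (hasTemperateGrowth_gradQ (hh i) i)
  have i2 := fun i => integrable_gibbs hS ((hasTemperateGrowth_mulVec_fst S⁻¹ i).fun_mul (hh i))
  refine (integral_finsetSum _ fun i _ => (i1 i).sub (i2 i)).trans
    (Finset.sum_eq_zero fun i _ => ?_)
  rw [integral_sub' (i1 i) (i2 i), integral_gradQ hS (hh i)]
  exact sub_self _

/-- The divergence theorem for a vector field on momenta, with respect to the Gibbs measure. -/
theorem integral_sum_gradP_sub (hS : S.PosDef) {h : Fin n → Phase n → ℝ}
    (hh : ∀ i, (h i).HasTemperateGrowth) :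
    ∫ z, ∑ i, (gradP (h i) z i - z.2 i * h i z) ∂gibbs S = 0 := by
  have i1 := fun i => integrable_gibbs hS (hasTemperateGrowth_gradP (hh i) i)
  have i2 := fun i => integrable_gibbs hS ((hasTemperateGrowth_snd_apply i).fun_mul (hh i))
  refine (integral_finsetSum _ fun i _ => (i1 i).sub (i2 i)).trans
    (Finset.sum_eq_zero fun i _ => ?_)
  rw [integral_sub' (i1 i) (i2 i), integral_gradP hS (hh i)]
  exact sub_self _

theorem gradQ_mul {a b : Phase n → ℝ} (ha : a.HasTemperateGrowth) (hb : b.HasTemperateGrowth)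
    (z : Phase n) (i : Fin n) :
    gradQ (fun w => a w * b w) z i = a z * gradQ b z i + gradQ a z i * b z := by
  have h1 := (ha.1.contDiffAt (x := z)).differentiableAt (by simp)
  have h2 := (hb.1.contDiffAt (x := z)).differentiableAt (by simp)
  simp only [gradQ, fderiv_fun_mul h1 h2, _root_.add_apply, _root_.smul_apply, smul_eq_mul]
  ring

theorem gradP_mul {a b : Phase n → ℝ} (ha : a.HasTemperateGrowth) (hb : b.HasTemperateGrowth)
    (z : Phase n) (i : Fin n) :
    gradP (fun w => a w * b w) z i = a z * gradP b z i + gradP a z i * b z := by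
  have h1 := (ha.1.contDiffAt (x := z)).differentiableAt (by simp)
  have h2 := (hb.1.contDiffAt (x := z)).differentiableAt (by simp)
  simp only [gradP, fderiv_fun_mul h1 h2, _root_.add_apply, _root_.smul_apply, smul_eq_mul]
  ring

theorem gradQ_snd_apply (z : Phase n) (i j : Fin n) : gradQ (fun w => w.2 i) z j = 0 := by
  have := fderiv_mulVec_snd 1 i z (Pi.single j 1, 0)
  simpa [gradQ] using this

theorem gradQ_mulVec_fst (M : Matrix (Fin n) (Fin n) ℝ) (z : Phase n) (i j : Fin n) :
    gradQ (fun w => (M *ᵥ w.1) i) z j = M i j := by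
  simp [gradQ, fderiv_mulVec_fst]

theorem gradP_mulVec_fst (M : Matrix (Fin n) (Fin n) ℝ) (z : Phase n) (i j : Fin n) :
    gradP (fun w => (M *ᵥ w.1) i) z j = 0 := by
  simp [gradP, fderiv_mulVec_fst]

/-- `ℒ` and `ℒ*` are adjoint to each other on functions of temperate growth. -/
theorem integral_mul_adjointGenerator {Γ : Matrix (Fin n) (Fin n) ℝ} (hS : S.PosDef)
    (hΓ : Γᵀ = Γ) (hφ : φ.HasTemperateGrowth) (hg : g.HasTemperateGrowth) :
    Integrable (fun z => generator S Γ φ z * g z - φ z * adjointGenerator S Γ g z) (gibbs S) ∧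
    ∫ z, (generator S Γ φ z * g z - φ z * adjointGenerator S Γ g z) ∂gibbs S = 0 := by
  have hφg := hφ.fun_mul hg
  have t1 : ∀ i, (fun z : Phase n => z.2 i * (φ z * g z)).HasTemperateGrowth := fun i =>
    (hasTemperateGrowth_snd_apply i).mul hφg
  have t2 : ∀ i, (fun z : Phase n => (S⁻¹ *ᵥ z.1) i * (φ z * g z)).HasTemperateGrowth := fun i =>
    (hasTemperateGrowth_mulVec_fst _ i).mul hφg
  have m3 : ∀ i, (fun z => (Γ *ᵥ gradP φ z) i).HasTemperateGrowth :=
    hasTemperateGrowth_mulVec Γ (hasTemperateGrowth_gradP hφ)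
  have m4 : ∀ i, (fun z => (Γ *ᵥ gradP g z) i).HasTemperateGrowth :=
    hasTemperateGrowth_mulVec Γ (hasTemperateGrowth_gradP hg)
  have t3 : ∀ i, (fun z => (Γ *ᵥ gradP φ z) i * g z).HasTemperateGrowth := fun i => (m3 i).mul hg
  have t4 : ∀ i, (fun z => (Γ *ᵥ gradP g z) i * φ z).HasTemperateGrowth := fun i => (m4 i).mul hφ
  -- The integrand is a sum of divergences with respect to the Gibbs measure: the first two come
  -- from the Hamiltonian transport of φg, the last two from the symmetric dissipative part.
  have key : ∀ z, generator S Γ φ z * g z - φ z * adjointGenerator S Γ g z =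
      ((∑ i, (gradQ (fun z : Phase n => z.2 i * (φ z * g z)) z i
          - (S⁻¹ *ᵥ z.1) i * (z.2 i * (φ z * g z))))
        - (∑ i, (gradP (fun z : Phase n => (S⁻¹ *ᵥ z.1) i * (φ z * g z)) z i
          - z.2 i * ((S⁻¹ *ᵥ z.1) i * (φ z * g z)))))
      + ((∑ i, (gradP (fun z => (Γ *ᵥ gradP φ z) i * g z) z i
          - z.2 i * ((Γ *ᵥ gradP φ z) i * g z)))
        - ∑ i, (gradP (fun z => (Γ *ᵥ gradP g z) i * φ z) z i
          - z.2 i * ((Γ *ᵥ gradP g z) i * φ z))) := by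
    intro z
    have e1 : (Γ *ᵥ z.2) ⬝ᵥ gradP φ z = z.2 ⬝ᵥ (Γ *ᵥ gradP φ z) := by
      rw [dotProduct_comm, dotProduct_mulVec_symm hΓ]
    have e2 : (Γ *ᵥ z.2) ⬝ᵥ gradP g z = z.2 ⬝ᵥ (Γ *ᵥ gradP g z) := by
      rw [dotProduct_comm, dotProduct_mulVec_symm hΓ]
    -- The first-order cross terms of the two dissipative divergences cancel because Γ is symmetric.
    have e3 : ∑ i, (Γ *ᵥ gradP φ z) i * gradP g z i = ∑ i, (Γ *ᵥ gradP g z) i * gradP φ z i := by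
      change (Γ *ᵥ gradP φ z) ⬝ᵥ gradP g z = (Γ *ᵥ gradP g z) ⬝ᵥ gradP φ z
      rw [dotProduct_comm, dotProduct_mulVec_symm hΓ, dotProduct_comm]
    have a1 : ∀ i, gradQ (fun z : Phase n => z.2 i * (φ z * g z)) z i =
        z.2 i * (φ z * gradQ g z i + gradQ φ z i * g z) := fun i => by
      rw [gradQ_mul (hasTemperateGrowth_snd_apply i) hφg, gradQ_snd_apply, gradQ_mul hφ hg]
      ring
    have a2 : ∀ i, gradP (fun z : Phase n => (S⁻¹ *ᵥ z.1) i * (φ z * g z)) z i =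
        (S⁻¹ *ᵥ z.1) i * (φ z * gradP g z i + gradP φ z i * g z) := fun i => by
      rw [gradP_mul (hasTemperateGrowth_mulVec_fst _ i) hφg, gradP_mulVec_fst, gradP_mul hφ hg]
      ring
    simp only [a1, a2, gradP_mul (m3 _) hg, gradP_mul (m4 _) hφ]
    simp only [Finset.sum_sub_distrib, Finset.sum_add_distrib, e3]
    simp only [generator, adjointGenerator, e1, e2, divGradP]
    simp only [dotProduct, add_mul, sub_mul, mul_add, mul_sub, Finset.sum_mul, Finset.mul_sum,
      mul_neg, Finset.sum_add_distrib]
    simp only [mul_comm, mul_left_comm, mul_assoc]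
    ring
  simp only [key]
  have I1 := integrable_sum_gradQ_sub hS t1
  have I2 := integrable_sum_gradP_sub hS t2
  have I3 := integrable_sum_gradP_sub hS t3
  have I4 := integrable_sum_gradP_sub hS t4
  refine ⟨(I1.sub I2).add (I3.sub I4), ?_⟩
  refine (integral_add (I1.sub I2) (I3.sub I4)).trans ?_
  rw [integral_sub' I1 I2, integral_sub' I3 I4,
    integral_sum_gradQ_sub hS t1, integral_sum_gradP_sub hS t2, integral_sum_gradP_sub hS t3,
    integral_sum_gradP_sub hS t4]
  simp

/-- Gaussian integration by parts for the linear vector field `q ↦ M q`. -/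
theorem integral_dotProduct_mulVec_mul (hS : S.PosDef) (M : Matrix (Fin n) (Fin n) ℝ)
    (hg : g.HasTemperateGrowth) :
    ∫ z, ((S⁻¹ *ᵥ z.1) ⬝ᵥ (M *ᵥ z.1)) * g z ∂gibbs S =
      M.trace * ∫ z, g z ∂gibbs S + ∫ z, (M *ᵥ z.1) ⬝ᵥ gradQ g z ∂gibbs S := by
  have hM := hasTemperateGrowth_mulVec_fst M
  have h0 := integral_sum_gradQ_sub hS (h := fun i z => (M *ᵥ z.1) i * g z)
    (fun i => (hM i).mul hg)
  have e : ∀ z, ∑ i, (gradQ (fun z : Phase n => (M *ᵥ z.1) i * g z) z i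
      - (S⁻¹ *ᵥ z.1) i * ((M *ᵥ z.1) i * g z)) =
      (M.trace * g z + (M *ᵥ z.1) ⬝ᵥ gradQ g z) - ((S⁻¹ *ᵥ z.1) ⬝ᵥ (M *ᵥ z.1)) * g z := by
    intro z
    simp only [gradQ_mul (hM _) hg, gradQ_mulVec_fst, Finset.sum_sub_distrib,
      Finset.sum_add_distrib, trace, diag, dotProduct, Finset.sum_mul]
    simp only [mul_assoc]
    ring
  have i1 := (integrable_gibbs hS hg).const_mul M.trace
  have i2 := integrable_gibbs hS (hasTemperateGrowth_dotProduct hM (hasTemperateGrowth_gradQ hg))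
  have i3 := integrable_gibbs hS ((hasTemperateGrowth_dotProduct
    (hasTemperateGrowth_mulVec_fst S⁻¹) hM).mul hg)
  simp only [e] at h0
  have h1 := (integral_sub (i1.add i2) i3).symm.trans h0
  rw [integral_add' i1 i2, integral_const_mul] at h1
  exact (sub_eq_zero.1 h1).symm

theorem integral_dotProduct_snd (hS : S.PosDef) (M : Matrix (Fin n) (Fin n) ℝ) :
    ∫ z, z.2 ⬝ᵥ (M *ᵥ z.1) ∂gibbs S = 0 := by
  have h0 := integral_sum_gradP_sub hS (h := fun i z => (M *ᵥ z.1) i)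
    (fun i => hasTemperateGrowth_mulVec_fst M i)
  simp only [gradP_mulVec_fst, zero_sub, Finset.sum_neg_distrib, integral_neg, neg_eq_zero] at h0
  exact h0

end Green


/-! ### The Lyapunov equation ΓC + CΓ = Q -/

section Lyapunov

variable {Γ C Q S U₀ : Matrix (Fin n) (Fin n) ℝ}

/-- Multiplying by Xᵀ and taking the trace gives Tr(XᵀΓX) + Tr(XΓXᵀ) = 0, so both nonnegative terms
vanish. Then XᵀΓX = 0, and definiteness of Γ kills each column of X. -/
theorem eq_zero_of_lyapunov (hΓ : Γ.PosDef) {X : Matrix (Fin n) (Fin n) ℝ}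
    (h : Γ * X + X * Γ = 0) : X = 0 := by
  have p1 : (Xᵀ * Γ * X).PosSemidef := by
    simpa using hΓ.posSemidef.conjTranspose_mul_mul_same X
  have p2 : (X * Γ * Xᵀ).PosSemidef := by
    simpa using hΓ.posSemidef.mul_mul_conjTranspose_same X
  have h0 : (Xᵀ * Γ * X).trace + (X * Γ * Xᵀ).trace = 0 := by
    rw [trace_mul_comm (X * Γ) Xᵀ, ← trace_add, Matrix.mul_assoc, ← Matrix.mul_add, h]
    simp
  have h1 : Xᵀ * Γ * X = 0 := p1.trace_eq_zero_iff.1 (by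
    linarith [p1.trace_nonneg, p2.trace_nonneg])
  refine Matrix.ext_of_mulVec_single fun j => ?_
  set x : Fin n → ℝ := Pi.single j 1
  by_contra hx
  rw [zero_mulVec] at hx
  have h2 : 0 < (X *ᵥ x) ⬝ᵥ (Γ *ᵥ (X *ᵥ x)) := by simpa using hΓ.dotProduct_mulVec_pos hx
  have h3 : x ⬝ᵥ ((Xᵀ * Γ * X) *ᵥ x) = (X *ᵥ x) ⬝ᵥ (Γ *ᵥ (X *ᵥ x)) := by
    rw [← mulVec_mulVec, ← mulVec_mulVec, dotProduct_mulVec, vecMul_transpose]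
  rw [h1, zero_mulVec, dotProduct_zero] at h3
  exact h2.ne h3

/-- In finite dimension, injectivity of X ↦ ΓX + XΓ gives surjectivity. -/
theorem exists_lyapunov (hΓ : Γ.PosDef) (Q : Matrix (Fin n) (Fin n) ℝ) :
    ∃ C, Γ * C + C * Γ = Q := by
  let L : Matrix (Fin n) (Fin n) ℝ →ₗ[ℝ] Matrix (Fin n) (Fin n) ℝ :=
    LinearMap.mulLeft ℝ Γ + LinearMap.mulRight ℝ Γ
  have hL : ∀ X, L X = Γ * X + X * Γ := fun X => rfl
  have hinj : Function.Injective L := (injective_iff_map_eq_zero L).2 fun X hX =>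
    eq_zero_of_lyapunov hΓ hX
  exact LinearMap.injective_iff_surjective.1 hinj Q

/-- By uniqueness, since Cᵀ solves the same equation as C. -/
theorem transpose_eq_of_lyapunov (hΓ : Γ.PosDef) (hQ : Qᵀ = Q) (h : Γ * C + C * Γ = Q) :
    Cᵀ = C := by
  have h1 : Γ * Cᵀ + Cᵀ * Γ = Q := by
    rw [← hQ, ← h, transpose_add, transpose_mul, transpose_mul, transpose_eq hΓ, add_comm]
  refine sub_eq_zero.1 (eq_zero_of_lyapunov hΓ ?_)
  rw [Matrix.mul_sub, Matrix.sub_mul, sub_add_sub_comm, h1, h, sub_self]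

/-- The commutator SC - CS solves the homogeneous equation. -/
theorem commute_of_lyapunov (hΓ : Γ.PosDef) (hSΓ : Commute S Γ) (hSQ : Commute S Q)
    (h : Γ * C + C * Γ = Q) : Commute S C := by
  refine sub_eq_zero.1 (eq_zero_of_lyapunov hΓ ?_)
  have h1 : S * (Γ * C + C * Γ) = (Γ * C + C * Γ) * S := by rw [h]; exact hSQ
  have e : S * Γ = Γ * S := hSΓ
  have a1 : Γ * (S * C) = S * (Γ * C) := by rw [← Matrix.mul_assoc, ← e, Matrix.mul_assoc]
  have a2 : C * S * Γ = C * Γ * S := by rw [Matrix.mul_assoc, e, Matrix.mul_assoc]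
  calc Γ * (S * C - C * S) + (S * C - C * S) * Γ
      = S * (Γ * C + C * Γ) - (Γ * C + C * Γ) * S := by
        rw [Matrix.mul_sub, Matrix.sub_mul, a1, a2]
        noncomm_ring
    _ = 0 := sub_eq_zero.2 h1

/-- For an eigenvector v of C with eigenvalue λ, v·Qv = 2λ v·Γv, which forces λ ≥ 0. -/
theorem posSemidef_of_lyapunov (hΓ : Γ.PosDef) (hQ : Q.PosSemidef) (h : Γ * C + C * Γ = Q) :
    C.PosSemidef := by
  have hCt : Cᵀ = C := transpose_eq_of_lyapunov hΓ (by simpa using hQ.1.eq) h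
  have hC : C.IsHermitian := by simpa [IsHermitian] using hCt
  rw [hC.posSemidef_iff_eigenvalues_nonneg]
  intro j
  set v : Fin n → ℝ := ⇑(hC.eigenvectorBasis j)
  have hCv : C *ᵥ v = hC.eigenvalues j • v := hC.mulVec_eigenvectorBasis j
  have hv0 : v ≠ 0 := fun h0 => hC.eigenvectorBasis.orthonormal.ne_zero j (by
    ext i; exact congrFun h0 i)
  have h1 : 0 < v ⬝ᵥ (Γ *ᵥ v) := by simpa using hΓ.dotProduct_mulVec_pos hv0
  have h2 : 0 ≤ v ⬝ᵥ (Q *ᵥ v) := by simpa using hQ.dotProduct_mulVec_nonneg v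
  have h3 : v ⬝ᵥ (Q *ᵥ v) = 2 * hC.eigenvalues j * (v ⬝ᵥ (Γ *ᵥ v)) := by
    rw [← h, add_mulVec, dotProduct_add, ← mulVec_mulVec, ← mulVec_mulVec,
      dotProduct_mulVec_symm hCt v, dotProduct_comm _ (C *ᵥ v), hCv]
    simp only [mulVec_smul, dotProduct_smul, smul_dotProduct, smul_eq_mul]
    ring
  rw [h3] at h2
  have := nonneg_of_mul_nonneg_left h2 h1
  simpa using this

/-- Writing P = MᴴM and cycling turns the trace into that of MQMᴴ. -/
theorem trace_mul_nonneg {P Q : Matrix (Fin n) (Fin n) ℝ} (hP : P.PosSemidef)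
    (hQ : Q.PosSemidef) : 0 ≤ (P * Q).trace := by
  obtain ⟨M, rfl⟩ := CStarAlgebra.nonneg_iff_eq_star_mul_self.1 hP.nonneg
  rw [Matrix.mul_assoc, trace_mul_comm]
  exact (hQ.mul_mul_conjTranspose_same M).trace_nonneg

end Lyapunov

/-! ### Powers of S and completing the square -/

section Rpow

variable {S U₀ Γ C : Matrix (Fin n) (Fin n) ℝ}

theorem posDef_rpow (hS : S.PosDef) (x : ℝ) : (S ^ x).PosDef :=
  (hS.isStrictlyPositive.rpow S x).posDef

theorem commute_rpow {X : Matrix (Fin n) (Fin n) ℝ} (h : Commute S X) (x : ℝ) :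
    Commute (S ^ x) X :=
  h.cfc_nnreal _

theorem rpow_half_mul_self (hS : S.PosDef) :
    S ^ (1 / 2 : ℝ) * S ^ (1 / 2 : ℝ) = S := by
  rw [← CFC.rpow_add hS.isUnit, add_halves, CFC.rpow_one S hS.posSemidef.nonneg]

theorem rpow_five_halves (hS : S.PosDef) :
    S ^ (5 / 2 : ℝ) = S * S * S ^ (1 / 2 : ℝ) := by
  have h2 : S ^ (2 : ℝ) = S * S := by
    have := CFC.rpow_natCast S 2 hS.posSemidef.nonneg
    rw [← pow_two, ← this]; norm_num
  rw [← h2, ← CFC.rpow_add hS.isUnit]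
  norm_num

/-- By commutation the product is the congruence S^{1/2} U₀ S^{1/2}. -/
theorem mul_posSemidef_of_commute (hS : S.PosDef) (hU : U₀.PosDef) (h : Commute S U₀) :
    (S * U₀).PosSemidef := by
  have hR := posDef_rpow hS (1 / 2)
  have e : S * U₀ = S ^ (1 / 2 : ℝ) * U₀ * (S ^ (1 / 2 : ℝ))ᴴ := by
    rw [hR.1.eq, Matrix.mul_assoc, ← (commute_rpow h (1 / 2)).eq, ← Matrix.mul_assoc,
      rpow_half_mul_self hS]
  rw [e]
  exact hU.posSemidef.mul_mul_conjTranspose_same _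

/-- The excess of the asymptotic variance over its minimum, in terms of the Lyapunov solution. -/
theorem trace_variance_eq (hS : S.PosDef) (hSU : Commute S U₀) (hSΓ : Commute S Γ)
    (hSC : Commute S C) (hC : Γ * C + C * Γ = S * U₀) :
    (S * U₀ * S * (S⁻¹ * C + Γ * C * Γ)).trace =
      (U₀ ^ 2 * S ^ (5 / 2 : ℝ)).trace +
        (S * U₀ * ((1 - S ^ (1 / 2 : ℝ) * Γ) * C * (1 - S ^ (1 / 2 : ℝ) * Γ))).trace := by
  rw [rpow_five_halves hS]
  have hRR := rpow_half_mul_self hS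
  have hRΓ := (commute_rpow hSΓ (1 / 2)).eq
  have hRC := (commute_rpow hSC (1 / 2)).eq
  have hRU := (commute_rpow hSU (1 / 2)).eq
  have hRS := (commute_rpow (Commute.refl S) (1 / 2)).eq
  have hinv : S * S⁻¹ = 1 := mul_nonsing_inv S ((isUnit_iff_isUnit_det S).1 hS.isUnit)
  set R := S ^ (1 / 2 : ℝ)
  have e1 : S * U₀ * S * (S⁻¹ * C + Γ * C * Γ) = S * U₀ * C + S * U₀ * S * Γ * C * Γ := by
    rw [Matrix.mul_add, ← Matrix.mul_assoc, Matrix.mul_assoc (S * U₀) S, hinv, Matrix.mul_one]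
    simp only [Matrix.mul_assoc]
  have e2 : R * Γ * C * (R * Γ) = S * (Γ * C * Γ) := by
    calc R * Γ * C * (R * Γ) = R * Γ * (C * R) * Γ := by simp only [Matrix.mul_assoc]
      _ = R * (Γ * R) * C * Γ := by rw [← hRC]; simp only [Matrix.mul_assoc]
      _ = S * (Γ * C * Γ) := by rw [← hRΓ, ← hRR]; simp only [Matrix.mul_assoc]
  -- The cross terms of the square. The Lyapunov equation makes their sum independent of Γ, so after
  -- multiplication by SU₀ they account for the minimal value.
  have e3 : R * Γ * C + C * (R * Γ) = R * (S * U₀) := by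
    rw [← hC, ← Matrix.mul_assoc C, ← hRC, Matrix.mul_add]
    simp only [Matrix.mul_assoc]
  have e4 : (1 - R * Γ) * C * (1 - R * Γ) = C - R * (S * U₀) + S * (Γ * C * Γ) := by
    rw [← e3, ← e2]; noncomm_ring
  have e5 : S * U₀ * (R * (S * U₀)) = U₀ * (S * S * R) * U₀ := by
    rw [hSU.eq]
    calc U₀ * S * (R * (U₀ * S)) = U₀ * S * (R * (S * U₀)) := by rw [hSU.eq]
      _ = U₀ * S * ((R * S) * U₀) := by simp only [Matrix.mul_assoc]
      _ = _ := by rw [hRS]; simp only [Matrix.mul_assoc]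
  rw [e1, e4, Matrix.mul_add, Matrix.mul_sub, e5, trace_add, trace_add, trace_sub,
    trace_mul_comm (U₀ * (S * S * R)) U₀, pow_two]
  simp only [Matrix.mul_assoc]
  ring

end Rpow


/-! ### The quadratic solution of the Poisson equation and its variance -/

section Poisson

variable {S U₀ Γ C : Matrix (Fin n) (Fin n) ℝ}

theorem inv_mul_self (hS : S.PosDef) : S⁻¹ * S = 1 :=
  nonsing_inv_mul S ((isUnit_iff_isUnit_det S).1 hS.isUnit)

theorem commute_inv (hS : S.PosDef) {X : Matrix (Fin n) (Fin n) ℝ} (h : Commute S X) :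
    S⁻¹ * X = X * S⁻¹ := by
  have h1 := inv_mul_self hS
  have h2 : S * S⁻¹ = 1 := mul_nonsing_inv S ((isUnit_iff_isUnit_det S).1 hS.isUnit)
  calc S⁻¹ * X = S⁻¹ * (X * S) * S⁻¹ := by
        rw [Matrix.mul_assoc, Matrix.mul_assoc, h2, Matrix.mul_one]
    _ = X * S⁻¹ := by rw [← h.eq, ← Matrix.mul_assoc, h1, Matrix.one_mul]

theorem inv_mulVec_dotProduct (hS : S.PosDef) (M : Matrix (Fin n) (Fin n) ℝ) (q : Fin n → ℝ) :
    (S⁻¹ *ᵥ q) ⬝ᵥ ((S * M) *ᵥ q) = q ⬝ᵥ (M *ᵥ q) := by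
  rw [dotProduct_comm, dotProduct_mulVec_symm (transpose_inv_eq hS), mulVec_mulVec,
    ← Matrix.mul_assoc, inv_mul_self hS, Matrix.one_mul]

theorem hasTemperateGrowth_observable (U₀ : Matrix (Fin n) (Fin n) ℝ) :
    (fun z : Phase n => observable U₀ z.1).HasTemperateGrowth :=
  (Function.HasTemperateGrowth.const _).mul (hasTemperateGrowth_dotProduct
    hasTemperateGrowth_fst_apply (hasTemperateGrowth_mulVec_fst U₀))

theorem hasTemperateGrowth_centred (S U₀ : Matrix (Fin n) (Fin n) ℝ) :
    (centred S U₀).HasTemperateGrowth :=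
  (hasTemperateGrowth_observable U₀).sub (.const _)

theorem integral_dotProduct_mulVec (hS : S.PosDef) (M : Matrix (Fin n) (Fin n) ℝ) :
    ∫ z, z.1 ⬝ᵥ (M *ᵥ z.1) ∂gibbs S = (S * M).trace := by
  have := isProbabilityMeasure_gibbs hS
  have h := integral_dotProduct_mulVec_mul hS (S * M) (g := fun _ => 1) (.const 1)
  have h0 : ∀ z : Phase n, gradQ (fun _ : Phase n => (1 : ℝ)) z = 0 := fun z => by
    ext i; simp [gradQ]
  simpa [inv_mulVec_dotProduct hS, h0] using h

theorem integral_observable (hS : S.PosDef) (U₀ : Matrix (Fin n) (Fin n) ℝ) :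
    ∫ q, observable U₀ q ∂target S = (1 / 2) * (S * U₀).trace := by
  rw [← integral_fst_gibbs hS]
  simp only [observable]
  rw [integral_const_mul, integral_dotProduct_mulVec hS]

/-- Writing q·U₀q = S⁻¹q·(SU₀)q and integrating by parts, the divergence term cancels the centring
constant. What remains is a second moment in q, plus a term linear in p with mean zero: neither `B`
nor its sign contributes. -/
theorem two_mul_integral_centred_mul_quadratic {A B : Matrix (Fin n) (Fin n) ℝ} (hS : S.PosDef)
    (hU : U₀ᵀ = U₀) (hA : Aᵀ = A) (hC : Cᵀ = C) :
    2 * ∫ z, centred S U₀ z * quadratic A B C z ∂gibbs S = (S * U₀ * S * A).trace := by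
  have hψ := hasTemperateGrowth_quadratic A B C
  have h1 := integral_dotProduct_mulVec_mul hS (S * U₀) hψ
  simp only [inv_mulVec_dotProduct hS, gradQ_quadratic hA hC] at h1
  have e : ∀ z : Phase n, ((S * U₀) *ᵥ z.1) ⬝ᵥ (A *ᵥ z.1 + B *ᵥ z.2) =
      z.1 ⬝ᵥ ((U₀ * S * A) *ᵥ z.1) + z.2 ⬝ᵥ ((Bᵀ * (S * U₀)) *ᵥ z.1) := by
    intro z
    rw [dotProduct_add, ← mulVec_mulVec z.1 Bᵀ, mulVec_transpose, ← dotProduct_comm,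
      dotProduct_comm z.2, ← dotProduct_mulVec, dotProduct_mulVec, ← mulVec_transpose,
      mulVec_mulVec, ← dotProduct_comm]
    congr 2
    rw [transpose_mul, hU, transpose_eq hS]
  have hq : ∀ M : Matrix (Fin n) (Fin n) ℝ,
      Integrable (fun z : Phase n => z.1 ⬝ᵥ (M *ᵥ z.1)) (gibbs S) := fun M =>
    integrable_gibbs hS (hasTemperateGrowth_dotProduct
      hasTemperateGrowth_fst_apply (hasTemperateGrowth_mulVec_fst M))
  have hpq : Integrable (fun z : Phase n => z.2 ⬝ᵥ ((Bᵀ * (S * U₀)) *ᵥ z.1)) (gibbs S) :=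
    integrable_gibbs hS (hasTemperateGrowth_dotProduct
      hasTemperateGrowth_snd_apply (hasTemperateGrowth_mulVec_fst _))
  have hqψ : Integrable (fun z : Phase n => (z.1 ⬝ᵥ (U₀ *ᵥ z.1)) * quadratic A B C z) (gibbs S) :=
    integrable_gibbs hS ((hasTemperateGrowth_dotProduct
      hasTemperateGrowth_fst_apply (hasTemperateGrowth_mulVec_fst U₀)).fun_mul hψ)
  simp only [e] at h1
  rw [integral_add (hq _) hpq, integral_dotProduct_mulVec hS, integral_dotProduct_snd hS,
    add_zero] at h1
  have h2 : ∀ z, centred S U₀ z * quadratic A B C z =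
      (1 / 2) * ((z.1 ⬝ᵥ (U₀ *ᵥ z.1)) * quadratic A B C z)
        - ((1 / 2) * (S * U₀).trace) * quadratic A B C z := by
    intro z
    rw [centred, integral_observable hS, observable]
    ring
  simp only [h2]
  rw [integral_sub (hqψ.const_mul _) ((integrable_gibbs hS hψ).const_mul _), integral_const_mul,
    integral_const_mul, h1]
  simp only [Matrix.mul_assoc]
  ring

/-- The coefficients of the quadratic solution of the Poisson equation, in terms of the solution
`C` of the Lyapunov equation `Γ C + C Γ = S U₀`. -/
theorem generator_quadratic (hS : S.PosDef) (hΓ : Γᵀ = Γ) (hC : Cᵀ = C) (hSC : Commute S C)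
    (hSΓ : Commute S Γ) (hL : Γ * C + C * Γ = S * U₀) :
    (S⁻¹ * C + Γ * C * Γ)ᵀ = S⁻¹ * C + Γ * C * Γ ∧
    (∀ z, generator S Γ (quadratic (S⁻¹ * C + Γ * C * Γ) (Γ * C) C) z =
      (1 / 2) * (S * U₀).trace - observable U₀ z.1) ∧
    ∀ z, adjointGenerator S Γ (quadratic (S⁻¹ * C + Γ * C * Γ) (-(Γ * C)) C) z =
      (1 / 2) * (S * U₀).trace - observable U₀ z.1 := by
  have hSi := transpose_inv_eq hS
  have hiC := commute_inv hS hSC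
  have hiΓ := commute_inv hS hSΓ
  have hA : (S⁻¹ * C + Γ * C * Γ)ᵀ = S⁻¹ * C + Γ * C * Γ := by
    simp only [transpose_add, transpose_mul, hC, hΓ, hSi, hiC, Matrix.mul_assoc]
  have htr : (Γ * C).trace = (1 / 2) * (S * U₀).trace := by
    rw [← hL, trace_add, trace_mul_comm C Γ]; ring
  have hB : (Γ * C)ᵀ = C * Γ := by rw [transpose_mul, hC, hΓ]
  have f1 : ∀ q p : Fin n → ℝ, (S⁻¹ *ᵥ q) ⬝ᵥ (C *ᵥ p) = p ⬝ᵥ ((S⁻¹ * C) *ᵥ q) := by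
    intro q p
    rw [dotProduct_mulVec_symm hC, mulVec_mulVec, hiC]
  have f2 : ∀ q p : Fin n → ℝ, (Γ *ᵥ p) ⬝ᵥ ((C * Γ) *ᵥ q) = p ⬝ᵥ ((Γ * C * Γ) *ᵥ q) := by
    intro q p
    rw [dotProduct_comm, dotProduct_mulVec_symm hΓ, mulVec_mulVec, Matrix.mul_assoc]
  have f3 : ∀ p : Fin n → ℝ, (Γ *ᵥ p) ⬝ᵥ (C *ᵥ p) = p ⬝ᵥ ((Γ * C) *ᵥ p) := by
    intro p
    rw [dotProduct_comm, dotProduct_mulVec_symm hΓ, mulVec_mulVec]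
  have f4 : ∀ q : Fin n → ℝ, (S⁻¹ *ᵥ q) ⬝ᵥ ((C * Γ) *ᵥ q) = observable U₀ q := by
    intro q
    have a1 : (S⁻¹ *ᵥ q) ⬝ᵥ ((C * Γ) *ᵥ q) = q ⬝ᵥ ((S⁻¹ * (C * Γ)) *ᵥ q) := by
      rw [dotProduct_comm, dotProduct_mulVec_symm hSi, mulVec_mulVec]
    -- A quadratic form sees only the symmetric part of its matrix, so the two orderings of Γ and C
    -- agree here although they need not commute.
    have a2 : q ⬝ᵥ ((S⁻¹ * (C * Γ)) *ᵥ q) = q ⬝ᵥ ((S⁻¹ * (Γ * C)) *ᵥ q) := by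
      have : (S⁻¹ * (C * Γ))ᵀ = S⁻¹ * (Γ * C) := by
        rw [transpose_mul, transpose_mul, hC, hΓ, hSi, Matrix.mul_assoc, ← hiC,
          ← Matrix.mul_assoc, ← hiΓ, Matrix.mul_assoc]
      rw [← this, mulVec_transpose, dotProduct_comm q (q ᵥ* _), ← dotProduct_mulVec]
    have a3 : q ⬝ᵥ ((S⁻¹ * (Γ * C)) *ᵥ q) + q ⬝ᵥ ((S⁻¹ * (C * Γ)) *ᵥ q) = q ⬝ᵥ (U₀ *ᵥ q) := by
      rw [← dotProduct_add, ← add_mulVec, ← Matrix.mul_add, hL, ← Matrix.mul_assoc,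
        inv_mul_self hS, Matrix.one_mul]
    rw [observable, ← a3, a1]
    linarith
  -- The p·p terms cancel by the choice of B, the mixed terms by the choice of A; the q·q terms give
  -- the observable and the trace gives its mean.
  refine ⟨hA, fun z => ?_, fun z => ?_⟩
  · rw [generator, gradQ_quadratic hA hC, gradP_quadratic hA hC, divGradP_quadratic hA hC, hB, htr]
    simp only [add_mulVec, dotProduct_add, f1, f2, f3, f4]
    ring
  · rw [adjointGenerator, gradQ_quadratic hA hC, gradP_quadratic hA hC, divGradP_quadratic hA hC,
      transpose_neg, hB, htr]
    simp only [add_mulVec, neg_mulVec, dotProduct_add, dotProduct_neg, f1, f2, f3, f4]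
    ring

theorem generator_sub_const (S Γ : Matrix (Fin n) (Fin n) ℝ) (φ : Phase n → ℝ) (m : ℝ)
    (z : Phase n) : generator S Γ (fun w => φ w - m) z = generator S Γ φ z := by
  have hQ : gradQ (fun w => φ w - m) = gradQ φ := by
    ext w i; simp only [gradQ, fderiv_sub_const]
  have hP : gradP (fun w => φ w - m) = gradP φ := by
    ext w i; simp only [gradP, fderiv_sub_const]
  simp only [generator, divGradP, hQ, hP]

/-- A solution of temperate growth of the pointwise equation solves it in the sense of
distributions. -/
theorem isPoissonSolution_of_generator (hS : S.PosDef) (hΓ : Γᵀ = Γ) {φ : Phase n → ℝ}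
    (hφ : φ.HasTemperateGrowth) (hmean : ∫ z, φ z ∂gibbs S = 0)
    (h : ∀ z, -generator S Γ φ z = centred S U₀ z) : IsPoissonSolution S U₀ Γ φ where
  memLp := memLp_two_gibbs hS hφ
  mean_zero := hmean
  weak g hg hgc := by
    have hg' := hgc.hasTemperateGrowth hg
    obtain ⟨i, h0⟩ := integral_mul_adjointGenerator hS hΓ hφ hg'
    have i1 : Integrable (fun z => generator S Γ φ z * g z) (gibbs S) := by
      refine (integrable_gibbs hS ((hasTemperateGrowth_centred S U₀).fun_mul hg')).neg.congr
        (.of_forall fun z => ?_)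
      simp only [Pi.neg_apply, ← h]; ring
    have i2 : Integrable (fun z => φ z * adjointGenerator S Γ g z) (gibbs S) := by
      refine (i1.sub i).congr (.of_forall fun z => ?_)
      simp
    rw [integral_sub i1 i2, sub_eq_zero] at h0
    rw [← h0, ← integral_neg]
    simp only [← h, neg_mul]

theorem exists_solution_and_variance (hS : S.PosDef) (hU : U₀.PosDef) (hSU : Commute S U₀)
    (hΓ : Γ ∈ commutingFrictions S) :
    ∃ C, C.PosSemidef ∧ Commute S C ∧ Γ * C + C * Γ = S * U₀ ∧
      (∃ φ, IsClassicalSolution S U₀ Γ φ ∧ IsPoissonSolution S U₀ Γ φ) ∧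
      IsAsymptoticVariance S U₀ Γ (S * U₀ * S * (S⁻¹ * C + Γ * C * Γ)).trace := by
  obtain ⟨hΓp, hΓS⟩ := hΓ
  have hSΓ : Commute S Γ := hΓS.symm
  have hΓt := transpose_eq hΓp
  obtain ⟨C, hL⟩ := exists_lyapunov hΓp (S * U₀)
  have hCp := posSemidef_of_lyapunov hΓp (mul_posSemidef_of_commute hS hU hSU) hL
  have hC : Cᵀ = C := by simpa using hCp.1.eq
  have hSC : Commute S C :=
    commute_of_lyapunov hΓp hSΓ ((Commute.refl S).mul_right hSU) hL
  obtain ⟨hA, hgen, hadj⟩ := generator_quadratic hS hΓt hC hSC hSΓ hL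
  have hprob := isProbabilityMeasure_gibbs hS
  set A := S⁻¹ * C + Γ * C * Γ
  have hcen : ∀ z, centred S U₀ z = -((1 / 2) * (S * U₀).trace - observable U₀ z.1) := fun z => by
    rw [centred, integral_observable hS]; ring
  set φ₀ := quadratic A (Γ * C) C
  have hφ₀ : φ₀.HasTemperateGrowth := hasTemperateGrowth_quadratic _ _ _
  set m := ∫ z, φ₀ z ∂gibbs S with hm
  have hφ : (fun z => φ₀ z - m).HasTemperateGrowth := hφ₀.fun_sub (.const m)
  have hpt : ∀ z, -generator S Γ (fun z => φ₀ z - m) z = centred S U₀ z := fun z => by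
    rw [generator_sub_const, hgen, hcen]
  have hsol : IsPoissonSolution S U₀ Γ (fun z => φ₀ z - m) := by
    refine isPoissonSolution_of_generator hS hΓt hφ ?_ hpt
    rw [integral_sub (integrable_gibbs hS hφ₀) (integrable_const m), ← hm]
    simp
  refine ⟨C, hCp, hSC, hL, ⟨_, ⟨hφ.1, hpt⟩, hsol⟩, ⟨_, hsol⟩, fun φ hφs => ?_⟩
  -- The test function is the quadratic solution of the adjoint equation, so the left side becomes
  -- the pairing of φ with f - π(f).
  have hw := weak_of_hasTemperateGrowth hS hφs.memLp
    (memLp_two_gibbs hS (hasTemperateGrowth_centred S U₀)) hφs.weak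
    (hasTemperateGrowth_quadratic A (-(Γ * C)) C)
  rw [← two_mul_integral_centred_mul_quadratic hS (transpose_eq hU) hA hC (B := -(Γ * C)), ← hw,
    ← integral_neg]
  simp only [hadj, hcen, mul_neg]

end Poisson

end Langevin

end

/-! ### Minimization over commuting frictions -/

theorem mainTheorem3 {n : ℕ} (S U₀ : Matrix (Fin n) (Fin n) ℝ)
    (hS : S.PosDef) (hU₀ : U₀.PosDef) (hcomm : S * U₀ = U₀ * S) :
    (∀ Γ ∈ Langevin.commutingFrictions S,
      (∃ φ, Langevin.IsClassicalSolution S U₀ Γ φ ∧ Langevin.IsPoissonSolution S U₀ Γ φ) ∧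
      ∃ v, Langevin.IsAsymptoticVariance S U₀ Γ v) ∧
    IsLeast {v : ℝ | ∃ Γ ∈ Langevin.commutingFrictions S, Langevin.IsAsymptoticVariance S U₀ Γ v}
      (Matrix.trace (U₀ ^ 2 * S ^ (5 / 2 : ℝ))) ∧
    S ^ (-(1 / 2) : ℝ) ∈ Langevin.commutingFrictions S ∧
    Langevin.IsAsymptoticVariance S U₀ (S ^ (-(1 / 2) : ℝ))
      (Matrix.trace (U₀ ^ 2 * S ^ (5 / 2 : ℝ))) := by
  have hmem : S ^ (-(1 / 2) : ℝ) ∈ Langevin.commutingFrictions S :=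
    ⟨Langevin.posDef_rpow hS _, (Langevin.commute_rpow (Commute.refl S) _).eq⟩
  have hopt : Langevin.IsAsymptoticVariance S U₀ (S ^ (-(1 / 2) : ℝ))
      (Matrix.trace (U₀ ^ 2 * S ^ (5 / 2 : ℝ))) := by
    obtain ⟨C, -, hSC, hL, -, hv⟩ :=
      Langevin.exists_solution_and_variance hS hU₀ hcomm hmem
    -- At this friction 1 - S^{1/2}Γ = 0 and the excess vanishes.
    have h1 : S ^ (1 / 2 : ℝ) * S ^ (-(1 / 2) : ℝ) = 1 :=
      CFC.rpow_mul_rpow_neg _ hS.isStrictlyPositive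
    rw [Langevin.trace_variance_eq hS hcomm hmem.2.symm hSC hL, h1] at hv
    simpa using hv
  refine ⟨fun Γ hΓ => ?_, ⟨⟨_, hmem, hopt⟩, ?_⟩, hmem, hopt⟩
  · obtain ⟨C, -, -, -, hφ, hv⟩ := Langevin.exists_solution_and_variance hS hU₀ hcomm hΓ
    exact ⟨hφ, _, hv⟩
  · rintro v ⟨Γ, hΓ, ⟨φ, hφ⟩, hv⟩
    obtain ⟨C, hC, hSC, hL, -, hv'⟩ := Langevin.exists_solution_and_variance hS hU₀ hcomm hΓ
    rw [← hv φ hφ, hv'.2 φ hφ, Langevin.trace_variance_eq hS hcomm hΓ.2.symm hSC hL]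
    refine le_add_of_nonneg_right (Langevin.trace_mul_nonneg
      (Langevin.mul_posSemidef_of_commute hS hU₀ hcomm) ?_)
    -- S^{1/2} and Γ commute, so this factor is symmetric and the excess contains a congruence of C.
    have hE : (1 - S ^ (1 / 2 : ℝ) * Γ)ᴴ = 1 - S ^ (1 / 2 : ℝ) * Γ := by
      rw [Matrix.conjTranspose_sub, Matrix.conjTranspose_one, Matrix.conjTranspose_mul,
        hΓ.1.1.eq, (Langevin.posDef_rpow hS _).1.eq,
        (Langevin.commute_rpow (S := S) (X := Γ) hΓ.2.symm (1 / 2)).eq]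
    have h := hC.mul_mul_conjTranspose_same (1 - S ^ (1 / 2 : ℝ) * Γ)
    rw [hE] at h
    exact h
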